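/- An order is a tuple consisting of an id, a timestamp, a quantity and a limit price, all natural numbers, with quantity at least $1$. Let $B$ be a finite list of orders called bids and $A$ a finite list of orders called asks, such that all the ids of the orders in $B$ and $A$ are distinct and all their timestamps are distinct. A transaction $(b,a,q,p)$ consists of a bid $b$, an ask $a$, a quantity $q$ and a price $p$. For a finite collection $M$ of transactions, $\mathrm{Vol}(M)$ is the sum of the quantities of all transactions in $M$, and $\mathrm{Qty}(w,M)$ is the sum of the quantities of those that involve the order $w$. $M$ is a matching over $(B,A)$ if every $(b,a,q,p)\in M$ satisfies $b\in B$, $a\in A$ and $\mathrm{price}(a)\le p\le \mathrm{price}(b)$, and $\mathrm{Qty}(w,M)\le \mathrm{qty}(w)$ for every order $w$ in $B$ or $A$. It is uniform if all its transactions have the same price $p$. A bid $b_1$ is more competitive than a bid $b_2$ if $\mathrm{price}(b_1)>\mathrm{price}(b_2)$, or the prices are equal and $b_1$ has the smaller timestamp; an ask $a_1$ is more competitive than an ask $a_2$ if $\mathrm{price}(a_1)<\mathrm{price}(a_2)$, or the prices are equal and $a_1$ has the smaller timestamp. $M$ is fair if, whenever $w_1$ is more competitive than $w_2$ (both in $B$,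 or both in $A$) and $\mathrm{Qty}(w_2,M)\ge 1$, one has $\mathrm{Qty}(w_1,M)=\mathrm{qty}(w_1)$. In the comparison model an algorithm has no access to the values of the prices: the only operation on prices, besides copying them, is to compare two of them, which takes one unit of time. Each other elementary step (memory access, addition, subtraction or comparison of numbers, allocation of a cell, test, function call) takes one unit of time as well. Theorem. There is an algorithm in the comparison model that, on every input $(B,A)$ as above, halts in time $O(n)$, where $n=|B|+|A|$, and outputs a list, without repetitions, of the transactions of a matching $M$ over $(B,A)$ that is uniform and fair and that has maximum volume: $\mathrm{Vol}(M')\le \mathrm{Vol}(M)$ for every uniform matching $M'$ over $(B,A)$, fair or not. -/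

import Mathlib

open Asymptotics Filter

namespace Exchange

/-! ### Orders, transactions, matchings -/

/-- An order (a bid or an ask, depending on the list in which it is placed). -/
structure Order where
  id : ℕ
  timestamp : ℕ
  qty : ℕ
  price : ℕ
  qty_pos : 1 ≤ qty
deriving DecidableEq

/-- A transaction: `qty` units change hands between `bid` and `ask`, at `price` per unit. -/
structure Transaction where
  bid : Order
  ask : Order
  qty : ℕ
  price : ℕ
deriving DecidableEq

/-- A bid `b` and an ask `a` are tradable. -/
def Tradable (b a : Order) : Prop := a.price ≤ b.price

/-- `Qty(w, M)`: the total quantity of the transactions in `M` that involve the order `w`. -/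
def tradedQty (w : Order) (M : List Transaction) : ℕ :=
  ((M.filter fun m => m.bid = w ∨ m.ask = w).map Transaction.qty).sum

/-- `Vol(M)`: the total quantity of all the transactions in `M`. -/
def volume (M : List Transaction) : ℕ := (M.map Transaction.qty).sum

/-- `M` is a matching over the bids `B` and the asks `A`. The price of a transaction respects the
limit prices of its bid and its ask. -/
structure IsMatching (B A : List Order) (M : List Transaction) : Prop where
  bid_mem : ∀ m ∈ M, m.bid ∈ B
  ask_mem : ∀ m ∈ M, m.ask ∈ A
  tradable : ∀ m ∈ M, Tradable m.bid m.ask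
  ask_price_le : ∀ m ∈ M, m.ask.price ≤ m.price
  price_le_bid : ∀ m ∈ M, m.price ≤ m.bid.price
  qty_le : ∀ w ∈ B ++ A, tradedQty w M ≤ w.qty

/-- All transactions occur at a common price. -/
def IsUniform (M : List Transaction) : Prop := ∃ p : ℕ, ∀ m ∈ M, m.price = p

/-- The bid `b₁` is more competitive than the bid `b₂`. -/
def BidMoreCompetitive (b₁ b₂ : Order) : Prop :=
  b₂.price < b₁.price ∨ (b₁.price = b₂.price ∧ b₁.timestamp < b₂.timestamp)

/-- The ask `a₁` is more competitive than the ask `a₂`. -/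
def AskMoreCompetitive (a₁ a₂ : Order) : Prop :=
  a₁.price < a₂.price ∨ (a₁.price = a₂.price ∧ a₁.timestamp < a₂.timestamp)

/-- `M` is fair on the bids `B`. -/
def FairOnBids (B : List Order) (M : List Transaction) : Prop :=
  ∀ b₁ ∈ B, ∀ b₂ ∈ B, BidMoreCompetitive b₁ b₂ → 1 ≤ tradedQty b₂ M → tradedQty b₁ M = b₁.qty

/-- `M` is fair on the asks `A`. -/
def FairOnAsks (A : List Order) (M : List Transaction) : Prop :=
  ∀ a₁ ∈ A, ∀ a₂ ∈ A, AskMoreCompetitive a₁ a₂ → 1 ≤ tradedQty a₂ M → tradedQty a₁ M = a₁.qty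

/-- `M` is fair. -/
def IsFair (B A : List Order) (M : List Transaction) : Prop := FairOnBids B M ∧ FairOnAsks A M

/-! ### The comparison model

Algorithms are programs of a first-order call-by-value language whose data are natural numbers,
prices, and immutable cons cells. Passing a value around is passing a number or a pointer. A price
is opaque: there are no price constants, no price arithmetic and no conversion between prices and
numbers, and the only operation that depends on prices is the comparison of two of them. Every
evaluated node of an expression (a variable access, an allocation or projection of a cell, an
addition or subtraction, a test, a comparison of two numbers or of two prices, a function call)
takes one unit of time. -/

/-- The data of a computation. -/
inductive Val where
  | nil : Val
  | nat (n : ℕ) : Val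
  | price (p : ℕ) : Val
  | pair (v w : Val) : Val

/-- Expressions. Variables are de Bruijn indices into the current environment. -/
inductive Expr where
  | var (i : ℕ) : Expr
  | nil : Expr
  | num (n : ℕ) : Expr
  | add (e₁ e₂ : Expr) : Expr
  | sub (e₁ e₂ : Expr) : Expr
  | pair (e₁ e₂ : Expr) : Expr
  | fst (e : Expr) : Expr
  | snd (e : Expr) : Expr
  /-- evaluate `e₁`, and then `e₂` with the value of `e₁` as the new variable `0` -/
  | bind (e₁ e₂ : Expr) : Expr
  /-- if `e` is the empty list then `e₁` else (if it is a cons cell) `e₂` -/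
  | ifNil (e e₁ e₂ : Expr) : Expr
  /-- if the number `l` is at most the number `r` then `e₁` else `e₂` -/
  | ifNatLe (l r e₁ e₂ : Expr) : Expr
  /-- the oracle: if the price `l` is at most the price `r` then `e₁` else `e₂` -/
  | ifPriceLe (l r e₁ e₂ : Expr) : Expr
  /-- call the function number `f` of the program with the value of `e` as its argument -/
  | call (f : ℕ) (e : Expr) : Expr

/-- A program: finitely many, possibly mutually recursive, functions of one argument (variable `0`
of the body), and a main expression whose variable `0` is the input. -/
structure Program where
  funs : List Expr
  main : Expr

/-- `Eval F ρ e v t`: with the function bodies `F` and in the environment `ρ`, the evaluation of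
`e` halts with the value `v` after `t` units of time. -/
inductive Eval (F : List Expr) : List Val → Expr → Val → ℕ → Prop where
  | var {ρ i v} : ρ[i]? = some v → Eval F ρ (.var i) v 1
  | nil {ρ} : Eval F ρ .nil .nil 1
  | num {ρ n} : Eval F ρ (.num n) (.nat n) 1
  | add {ρ e₁ e₂ m n s t} : Eval F ρ e₁ (.nat m) s → Eval F ρ e₂ (.nat n) t →
      Eval F ρ (.add e₁ e₂) (.nat (m + n)) (s + t + 1)
  | sub {ρ e₁ e₂ m n s t} : Eval F ρ e₁ (.nat m) s → Eval F ρ e₂ (.nat n) t →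
      Eval F ρ (.sub e₁ e₂) (.nat (m - n)) (s + t + 1)
  | pair {ρ e₁ e₂ v w s t} : Eval F ρ e₁ v s → Eval F ρ e₂ w t →
      Eval F ρ (.pair e₁ e₂) (.pair v w) (s + t + 1)
  | fst {ρ e v w t} : Eval F ρ e (.pair v w) t → Eval F ρ (.fst e) v (t + 1)
  | snd {ρ e v w t} : Eval F ρ e (.pair v w) t → Eval F ρ (.snd e) w (t + 1)
  | bind {ρ e₁ e₂ v w s t} : Eval F ρ e₁ v s → Eval F (v :: ρ) e₂ w t →
      Eval F ρ (.bind e₁ e₂) w (s + t + 1)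
  | ifNil_nil {ρ e e₁ e₂ w s t} : Eval F ρ e .nil s → Eval F ρ e₁ w t →
      Eval F ρ (.ifNil e e₁ e₂) w (s + t + 1)
  | ifNil_pair {ρ e e₁ e₂ v v' w s t} : Eval F ρ e (.pair v v') s → Eval F ρ e₂ w t →
      Eval F ρ (.ifNil e e₁ e₂) w (s + t + 1)
  | ifNatLe_le {ρ l r e₁ e₂ m n w s s' t} : Eval F ρ l (.nat m) s → Eval F ρ r (.nat n) s' →
      m ≤ n → Eval F ρ e₁ w t → Eval F ρ (.ifNatLe l r e₁ e₂) w (s + s' + t + 1)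
  | ifNatLe_gt {ρ l r e₁ e₂ m n w s s' t} : Eval F ρ l (.nat m) s → Eval F ρ r (.nat n) s' →
      n < m → Eval F ρ e₂ w t → Eval F ρ (.ifNatLe l r e₁ e₂) w (s + s' + t + 1)
  | ifPriceLe_le {ρ l r e₁ e₂ p q w s s' t} : Eval F ρ l (.price p) s →
      Eval F ρ r (.price q) s' → p ≤ q → Eval F ρ e₁ w t →
      Eval F ρ (.ifPriceLe l r e₁ e₂) w (s + s' + t + 1)
  | ifPriceLe_gt {ρ l r e₁ e₂ p q w s s' t} : Eval F ρ l (.price p) s →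
      Eval F ρ r (.price q) s' → q < p → Eval F ρ e₂ w t →
      Eval F ρ (.ifPriceLe l r e₁ e₂) w (s + s' + t + 1)
  | call {ρ f e body v w s t} : F[f]? = some body → Eval F ρ e v s → Eval F [v] body w t →
      Eval F ρ (.call f e) w (s + t + 1)

/-- The program `P` halts on the input `v` with the output `w` after `t` units of time. -/
def Program.HaltsWith (P : Program) (v w : Val) (t : ℕ) : Prop := Eval P.funs [v] P.main w t

/-- Evaluation is deterministic: the output and the running time are functions of the input. -/
theorem Eval.unique {F : List Expr} {ρ : List Val} {e : Expr} {v w : Val} {s t : ℕ}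
    (h : Eval F ρ e v s) (h' : Eval F ρ e w t) : v = w ∧ s = t := by
  induction h generalizing w t with
  | var h => cases h'; simp_all
  | nil => cases h'; simp
  | num => cases h'; simp
  | fst _ ih => cases h' with | fst h => have := ih h; simp_all
  | snd _ ih => cases h' with | snd h => have := ih h; simp_all
  | add _ _ ih₁ ih₂ => cases h' with | add h₁ h₂ => have := ih₁ h₁; have := ih₂ h₂; simp_all
  | sub _ _ ih₁ ih₂ => cases h' with | sub h₁ h₂ => have := ih₁ h₁; have := ih₂ h₂; simp_all
  | pair _ _ ih₁ ih₂ => cases h' with | pair h₁ h₂ => have := ih₁ h₁; have := ih₂ h₂; simp_all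
  | bind _ _ ih₁ ih₂ =>
    cases h' with
    | bind h₁ h₂ => obtain ⟨rfl, rfl⟩ := ih₁ h₁; have := ih₂ h₂; simp_all
  | ifNil_nil _ _ ih₁ ih₂ =>
    cases h' with
    | ifNil_nil h₁ h₂ => have := ih₁ h₁; have := ih₂ h₂; simp_all
    | ifNil_pair h₁ h₂ => have := ih₁ h₁; simp_all
  | ifNil_pair _ _ ih₁ ih₂ =>
    cases h' with
    | ifNil_nil h₁ h₂ => have := ih₁ h₁; simp_all
    | ifNil_pair h₁ h₂ => have := ih₁ h₁; have := ih₂ h₂; simp_all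
  | ifNatLe_le _ _ hle _ ih₁ ih₂ ih₃ =>
    cases h' with
    | ifNatLe_le h₁ h₂ _ h₃ => have := ih₁ h₁; have := ih₂ h₂; have := ih₃ h₃; simp_all
    | ifNatLe_gt h₁ h₂ hlt _ => have := ih₁ h₁; have := ih₂ h₂; simp_all; omega
  | ifNatLe_gt _ _ hlt _ ih₁ ih₂ ih₃ =>
    cases h' with
    | ifNatLe_le h₁ h₂ hle _ => have := ih₁ h₁; have := ih₂ h₂; simp_all; omega
    | ifNatLe_gt h₁ h₂ _ h₃ => have := ih₁ h₁; have := ih₂ h₂; have := ih₃ h₃; simp_all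
  | ifPriceLe_le _ _ hle _ ih₁ ih₂ ih₃ =>
    cases h' with
    | ifPriceLe_le h₁ h₂ _ h₃ => have := ih₁ h₁; have := ih₂ h₂; have := ih₃ h₃; simp_all
    | ifPriceLe_gt h₁ h₂ hlt _ => have := ih₁ h₁; have := ih₂ h₂; simp_all; omega
  | ifPriceLe_gt _ _ hlt _ ih₁ ih₂ ih₃ =>
    cases h' with
    | ifPriceLe_le h₁ h₂ hle _ => have := ih₁ h₁; have := ih₂ h₂; simp_all; omega
    | ifPriceLe_gt h₁ h₂ _ h₃ => have := ih₁ h₁; have := ih₂ h₂; have := ih₃ h₃; simp_all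
  | call hf _ _ ih₁ ih₂ =>
    cases h' with
    | call hf' h₁ h₂ =>
      obtain ⟨rfl, rfl⟩ := ih₁ h₁
      obtain rfl := Option.some.inj (hf.symm.trans hf')
      have := ih₂ h₂
      simp_all

/-! ### Input and output -/

/-- A list as a chain of cons cells. -/
def encodeList {α : Type} (enc : α → Val) : List α → Val
  | [] => .nil
  | x :: l => .pair (enc x) (encodeList enc l)

/-- The tuple (id, timestamp, quantity, price), with an opaque price. -/
def encodeOrder (w : Order) : Val :=
  .pair (.nat w.id) (.pair (.nat w.timestamp) (.pair (.nat w.qty) (.price w.price)))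

/-- The tuple (id of the bid, id of the ask, quantity, price), with an opaque price. -/
def encodeTransaction (m : Transaction) : Val :=
  .pair (.nat m.bid.id) (.pair (.nat m.ask.id) (.pair (.nat m.qty) (.price m.price)))

/-- The input that consists of the list of bids `B` and the list of asks `A`. -/
def encodeInput (B A : List Order) : Val :=
  .pair (encodeList encodeOrder B) (encodeList encodeOrder A)

/-- The output that lists the transactions in `M`. -/
def encodeOutput (M : List Transaction) : Val := encodeList encodeTransaction M

end Exchange

/-!
Rank all orders in one book, from the most competitive ask upwards and up to the most competitive
bid, asks before bids at equal prices; an ask and a bid are tradable if and only if the ask comes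
first. Let `x` be an entry at which the total weight of the bids, measured from the bottom of the
book, is reached. Then the bids above `x` and the asks below `x` differ in weight by no more than
`x` can make up for, so that all of them trade in full at the price of `x`. In any other uniform
matching, either all the bids that trade are above `x` or all the asks that trade are below `x`,
which bounds its volume. The entry `x` is a weighted quantile of the unsorted book. To find it in
linear time, the pivots are medians of medians of triples: a median of triples alone would leave
recursive calls of total length `n / 3 + 2 * n / 3`, whereas two rounds leave `n / 9 + 7 * n / 9`.
-/

namespace Exchange

/-! ### Weighted lists -/

section WeightedList

variable {α β γ : Type*}

/-- The total weight of a list whose entries carry their weights in the first component. -/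
def weight (L : List (ℕ × α)) : ℕ := (L.map Prod.fst).sum

theorem weight_cons (y : ℕ × α) (L : List (ℕ × α)) : weight (y :: L) = y.1 + weight L :=
  List.sum_cons

theorem weight_append (L₁ L₂ : List (ℕ × α)) : weight (L₁ ++ L₂) = weight L₁ + weight L₂ := by
  simp only [weight, List.map_append, List.sum_append]

theorem weight_eq_mul_length {c : ℕ} {L : List (ℕ × α)} (h : ∀ y ∈ L, y.1 = c) :
    weight L = c * L.length := by
  rw [weight, List.sum_eq_card_nsmul _ c (by simpa using fun a b hab => h _ hab), List.length_map,
    smul_eq_mul, mul_comm]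

theorem weight_le_of_sublist {L₁ L₂ : List (ℕ × α)} (h : L₁.Sublist L₂) :
    weight L₁ ≤ weight L₂ :=
  (h.map _).sum_le_sum fun _ _ => Nat.zero_le _

theorem weight_filter_add_weight_filter_le (p q : ℕ × α → Bool) (L : List (ℕ × α)) :
    weight (L.filter p) + weight (L.filter q) ≤ weight ((L.filter q).filter p) + weight L := by
  induction L with
  | nil => rfl
  | cons y L ih =>
    cases hp : p y <;> cases hq : q y <;>
      simp only [List.filter_cons, hp, hq, weight_cons, if_true, if_false, Bool.false_eq_true] <;>
      omega

theorem weight_filter_eq_of_mem [DecidableEq γ] {f : α → γ} {L : List (ℕ × α)}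
    (hL : (L.map fun z => f z.2).Nodup) {y : ℕ × α} (hy : y ∈ L) :
    weight (L.filter fun z => f z.2 = f y.2) = y.1 := by
  classical
  have h : L.filter (fun z => f z.2 = f y.2) = [y] := calc
    _ = L.filter (· = y) := List.filter_congr fun z hz => decide_eq_decide.2
      ⟨fun e => List.inj_on_of_nodup_map hL hz hy e, fun e => e ▸ rfl⟩
    _ = [y] := by rw [List.filter_eq, List.count_eq_one_of_mem hL.of_map hy, List.replicate_one]
  simp [h, weight]

variable [LinearOrder β]

/-- The entries of `L` that are ranked before `x` by `r`. The rank is a parameter so that every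
statement about `below` yields one about `above` on passing to the order dual. -/
def below (r : α → β) (x : α) (L : List (ℕ × α)) : List (ℕ × α) := L.filter fun y => r y.2 < r x

/-- The entries of `L` that are ranked after `x` by `r`. -/
def above (r : α → β) (x : α) (L : List (ℕ × α)) : List (ℕ × α) := L.filter fun y => r x < r y.2

variable {r : α → β} {x : α} {L L₁ L₂ : List (ℕ × α)}

theorem mem_below {y : ℕ × α} : y ∈ below r x L ↔ y ∈ L ∧ r y.2 < r x := by
  simp only [below, List.mem_filter, decide_eq_true_eq]

theorem mem_above {y : ℕ × α} : y ∈ above r x L ↔ y ∈ L ∧ r x < r y.2 := by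
  simp only [above, List.mem_filter, decide_eq_true_eq]

theorem length_below_lt_length {y : ℕ × α} (hy : y ∈ L) : (below r y.2 L).length < L.length :=
  List.length_filter_lt_length_iff_exists.2 ⟨y, hy, by simp⟩

theorem length_above_lt_length {y : ℕ × α} (hy : y ∈ L) : (above r y.2 L).length < L.length :=
  length_below_lt_length (r := OrderDual.toDual ∘ r) hy

theorem below_append : below r x (L₁ ++ L₂) = below r x L₁ ++ below r x L₂ :=
  List.filter_append ..

theorem above_append : above r x (L₁ ++ L₂) = above r x L₁ ++ above r x L₂ :=
  List.filter_append ..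

theorem below_below_of_lt {p : α} (hx : r x < r p) : below r x (below r p L) = below r x L := by
  rw [below, below, List.filter_filter]
  refine List.filter_congr fun y _ => ?_
  simpa only [Bool.and_eq_left_iff_imp, decide_eq_true_eq] using fun h => h.trans hx

theorem weight_below_add_weight_above :
    weight (below r x L) + weight (L.filter fun y => r y.2 = r x) + weight (above r x L) =
      weight L := by
  induction L with
  | nil => rfl
  | cons y L ih =>
    simp only [below, above, List.filter_cons, decide_eq_true_eq] at ih ⊢
    rcases lt_trichotomy (r y.2) (r x) with h | h | h
    · simp only [h, h.ne, h.not_gt, if_true, if_false, weight_cons]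
      omega
    · simp only [h, lt_irrefl, if_true, if_false, weight_cons]
      omega
    · simp only [h, h.ne', h.not_gt, if_true, if_false, weight_cons]
      omega

/-- `x` splits `L` at `k` units from the bottom and `l` units from the top: what is ranked before
`x` fits into the former and what is ranked after `x` fits into the latter. It is used when
`k + l` is the weight of `L`, so that `x` is the weighted quantile at `k`. -/
structure IsSplit (r : α → β) (x : α) (k l : ℕ) (L : List (ℕ × α)) : Prop where
  weight_below_le : weight (below r x L) ≤ k
  weight_above_le : weight (above r x L) ≤ l

open OrderDual in
theorem IsSplit.dual {k l : ℕ} (h : IsSplit r x k l L) : IsSplit (toDual ∘ r) x l k L :=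
  ⟨h.2, h.1⟩

theorem IsSplit.perm {k l : ℕ} (h : IsSplit r x k l L₁) (hp : L₁.Perm L₂) :
    IsSplit r x k l L₂ :=
  ⟨((hp.filter _).map _).sum_eq.symm.trans_le h.1, ((hp.filter _).map _).sum_eq.symm.trans_le h.2⟩

theorem IsSplit.of_below {p : α} {k l : ℕ} (hx : r x < r p) (hk : k ≤ weight (below r p L))
    (hL : weight L = k + l) (h : IsSplit r x k (weight (below r p L) - k) (below r p L)) :
    IsSplit r x k l L := by
  have hb := h.weight_below_le
  have ha := h.weight_above_le
  rw [below_below_of_lt hx] at hb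
  have : weight (above r x L) + weight (below r p L) ≤
      weight (above r x (below r p L)) + weight L := weight_filter_add_weight_filter_le ..
  exact ⟨hb, by omega⟩

open OrderDual in
theorem IsSplit.of_above {p : α} {k l : ℕ} (hx : r p < r x) (hl : l ≤ weight (above r p L))
    (hL : weight L = k + l) (h : IsSplit r x (weight (above r p L) - l) l (above r p L)) :
    IsSplit r x k l L :=
  (IsSplit.of_below (r := toDual ∘ r) (x := x) (p := p) hx hl (hL.trans (add_comm k l)) h.dual).dual

/-! ### Medians of medians -/

/-- A median of `x`, `y` and `z` with respect to the rank `r`. -/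
def median (r : α → β) (x y z : α) : α :=
  if r x ≤ r y then if r y ≤ r z then y else if r x ≤ r z then z else x
  else if r x ≤ r z then x else if r y ≤ r z then z else y

theorem exists_perm_median (r : α → β) (x y z : α) : ∃ a b,
    [a, median r x y z, b].Perm [x, y, z] ∧ r a ≤ r (median r x y z) ∧
      r (median r x y z) ≤ r b := by
  unfold median
  split_ifs with h₁ h₂ h₃ h₂ h₃
  · exact ⟨x, z, .refl _, h₁, h₂⟩
  · exact ⟨x, y, .cons _ (.swap ..), h₃, (not_le.1 h₂).le⟩
  · exact ⟨z, y, List.perm_append_comm (l₁ := [z]) (l₂ := [x, y]), (not_le.1 h₃).le, h₁⟩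
  · exact ⟨y, z, .swap .., (not_le.1 h₁).le, h₂⟩
  · exact ⟨y, x, List.perm_append_comm (l₁ := [y, z]) (l₂ := [x]), h₃, (not_le.1 h₂).le⟩
  · exact ⟨z, x, List.reverse_perm [x, y, z], (not_le.1 h₃).le, (not_le.1 h₁).le⟩

/-- The medians of the consecutive triples of `L`. They all get the same weight; the weight `2`
makes half of their total weight a whole number. -/
def medians (r : α → β) : List (ℕ × α) → List (ℕ × α)
  | x :: y :: z :: L => (2, median r x.2 y.2 z.2) :: medians r L
  | _ => []

theorem length_medians (r : α → β) (L : List (ℕ × α)) : (medians r L).length = L.length / 3 := by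
  fun_induction medians r L with
  | case1 x y z L ih =>
    simp only [List.length_cons, ih]
    omega
  | case2 L h =>
    match L, h with
    | [], _ | [_], _ | [_, _], _ => simp
    | x :: y :: z :: L, h => exact (h x y z L rfl).elim

theorem fst_of_mem_medians {y : ℕ × α} (hy : y ∈ medians r L) : y.1 = 2 := by
  fun_induction medians r L <;> grind

theorem exists_mem_of_mem_medians {y : ℕ × α} (hy : y ∈ medians r L) : ∃ z ∈ L, z.2 = y.2 := by
  fun_induction medians r L with
  | case1 x y z L ih =>
    obtain ⟨a, b, hp, -⟩ := exists_perm_median r x.2 y.2 z.2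
    have := hp.subset (a := median r x.2 y.2 z.2) (by simp)
    grind
  | case2 => simp at hy

/-- If a median of three lies outside an interval, then so does another one of the three. -/
theorem length_filter_add_two_mul_length_medians_le {S : Set β} [DecidablePred (· ∈ S)]
    (hS : S.OrdConnected) (L : List (ℕ × α)) :
    (L.filter fun y => r y.2 ∈ S).length + 2 * (medians r L).length ≤
      L.length + 2 * ((medians r L).filter fun y => r y.2 ∈ S).length := by
  fun_induction medians r L with
  | case1 x y z L ih =>
    obtain ⟨a, b, hp, ha, hb⟩ := exists_perm_median r x.2 y.2 z.2
    have hcount := hp.countP_eq fun u => decide (r u ∈ S)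
    have hmed : r a ∈ S → r b ∈ S → r (median r x.2 y.2 z.2) ∈ S :=
      fun h₁ h₂ => hS.out h₁ h₂ ⟨ha, hb⟩
    simp only [← List.countP_eq_length_filter, List.countP_cons, List.countP_nil,
      decide_eq_true_eq, List.length_cons] at hcount ih ⊢
    grind
  | case2 L => simpa using List.length_filter_le ..

theorem length_filter_add_two_mul_length_medians_medians_le {S : Set β}
    [DecidablePred (· ∈ S)] (hS : S.OrdConnected)
    (h : weight ((medians r (medians r L)).filter fun y => r y.2 ∈ S) ≤
      (medians r (medians r L)).length) :
    (L.filter fun y => r y.2 ∈ S).length + 2 * (medians r (medians r L)).length ≤ L.length := by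
  have h₁ := length_filter_add_two_mul_length_medians_le (r := r) hS L
  have h₂ := length_filter_add_two_mul_length_medians_le (r := r) hS (medians r L)
  rw [weight_eq_mul_length fun y hy => fst_of_mem_medians (List.mem_of_mem_filter hy)] at h
  omega

theorem IsSplit.length_below_medians_medians_le
    (h : IsSplit r x (medians r (medians r L)).length (medians r (medians r L)).length
      (medians r (medians r L))) :
    (below r x L).length + 2 * (medians r (medians r L)).length ≤ L.length :=
  length_filter_add_two_mul_length_medians_medians_le (S := Set.Iio (r x))
    Set.ordConnected_Iio h.weight_below_le

theorem IsSplit.length_above_medians_medians_le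
    (h : IsSplit r x (medians r (medians r L)).length (medians r (medians r L)).length
      (medians r (medians r L))) :
    (above r x L).length + 2 * (medians r (medians r L)).length ≤ L.length :=
  length_filter_add_two_mul_length_medians_medians_le (S := Set.Ioi (r x))
    Set.ordConnected_Ioi h.weight_above_le

/-! ### Truncations -/

/-- Giving `y` the difference of the two weights as its own weight balances the two sides. -/
theorem weight_below_le_and_weight_above_le {y : ℕ × α} (hy : y ∈ L₁)
    (hL₁ : (L₁.map fun z => r z.2).Nodup) (hL₂ : ∀ z ∈ L₂, r z.2 ≠ r y.2)
    (hs : IsSplit r y.2 (weight L₂) (weight L₁) (L₂ ++ L₁)) :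
    weight (below r y.2 L₁) ≤ weight (above r y.2 L₂) ∧
      weight (above r y.2 L₂) ≤ weight (below r y.2 L₁) + y.1 := by
  have h₁ := weight_below_add_weight_above (r := r) (x := y.2) (L := L₁)
  have h₂ := weight_below_add_weight_above (r := r) (x := y.2) (L := L₂)
  rw [weight_filter_eq_of_mem hL₁ hy] at h₁
  rw [List.filter_eq_nil_iff.2 (by simpa using fun a b h => hL₂ (a, b) h)] at h₂
  have hb := hs.weight_below_le
  have ha := hs.weight_above_le
  rw [below_append, weight_append] at hb
  rw [above_append, weight_append] at ha
  rw [show weight ([] : List (ℕ × α)) = 0 from rfl] at h₂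
  omega

/-- The list `P` consists of the entries of `L` ranked before `x`, in full, and at most one further
entry, at `x` itself and possibly with a smaller weight. -/
structure IsTruncation (r : α → β) (x : α) (L P : List (ℕ × α)) : Prop where
  below_sublist : (below r x L).Sublist P
  rank_le : ∀ y ∈ P, r y.2 ≤ r x
  exists_mem : ∀ y ∈ P, ∃ z ∈ L, z.2 = y.2 ∧ y.1 ≤ z.1
  subperm : (P.map Prod.snd).Subperm (L.map Prod.snd)

theorem isTruncation_below (r : α → β) (x : α) (L : List (ℕ × α)) :
    IsTruncation r x L (below r x L) where
  below_sublist := .refl _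
  rank_le _ hy := (mem_below.1 hy).2.le
  exists_mem y hy := ⟨y, (mem_below.1 hy).1, rfl, le_rfl⟩
  subperm := (List.filter_sublist.map _).subperm

theorem isTruncation_cons (r : α → β) {y : ℕ × α} (hy : y ∈ L) {q : ℕ} (hq : q ≤ y.1) :
    IsTruncation r y.2 L ((q, y.2) :: below r y.2 L) where
  below_sublist := .cons _ (.refl _)
  rank_le := List.forall_mem_cons.2 ⟨le_rfl, (isTruncation_below ..).rank_le⟩
  exists_mem := List.forall_mem_cons.2 ⟨⟨y, hy, rfl, hq⟩, (isTruncation_below ..).exists_mem⟩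
  subperm := by
    have h : y ∈ L.filter fun z => !decide (r z.2 < r y.2) := by simp [hy]
    obtain ⟨l, hl, hs⟩ := ((List.singleton_subperm_iff.2 h).append (.refl _)).trans
      (List.perm_append_comm.trans (List.filter_append_perm ..)).subperm
    exact ⟨l.map Prod.snd, hl.map _, hs.map _⟩

end WeightedList

/-! ### The order book -/

/-- An entry of the order book: an order together with its side. -/
inductive Key where
  | ask (a : Order)
  | bid (b : Order)

/-- The order of an entry of the order book. -/
def Key.order : Key → Order
  | ask a => a
  | bid b => b

/-- The precedence of an entry among those of the same price: asks come before bids, earlier asks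
before later asks, and later bids before earlier bids. -/
def Key.turn : Key → ℕ ⊕ₗ ℕᵒᵈ
  | ask a => Sum.inlₗ a.timestamp
  | bid b => Sum.inrₗ (OrderDual.toDual b.timestamp)

/-- The position of an entry in the order book, from the most competitive ask upwards and up to
the most competitive bid. An ask and a bid are tradable if and only if the ask comes first. -/
def Key.rank (x : Key) : ℕ ×ₗ (ℕ ⊕ₗ ℕᵒᵈ) := toLex (x.order.price, x.turn)

open Key

theorem rank_le_rank_iff {x y : Key} : x.rank ≤ y.rank ↔
    x.order.price < y.order.price ∨ x.order.price = y.order.price ∧ x.turn ≤ y.turn :=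
  Prod.Lex.toLex_le_toLex

theorem rank_lt_rank_iff {x y : Key} : x.rank < y.rank ↔
    x.order.price < y.order.price ∨ x.order.price = y.order.price ∧ x.turn < y.turn :=
  Prod.Lex.toLex_lt_toLex

theorem price_le_of_rank_le {x y : Key} (h : x.rank ≤ y.rank) :
    x.order.price ≤ y.order.price := by
  rcases rank_le_rank_iff.1 h with h | h
  exacts [h.le, h.1.le]

theorem rank_ask_lt_rank_ask {a₁ a₂ : Order} :
    (ask a₁).rank < (ask a₂).rank ↔ AskMoreCompetitive a₁ a₂ := by
  simp only [rank_lt_rank_iff, turn, Sum.Lex.inl_lt_inl_iff]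
  rfl

theorem rank_bid_lt_rank_bid {b₁ b₂ : Order} :
    (bid b₁).rank < (bid b₂).rank ↔ BidMoreCompetitive b₂ b₁ := by
  simp only [rank_lt_rank_iff, turn, Sum.Lex.inr_lt_inr_iff, OrderDual.toDual_lt_toDual,
    BidMoreCompetitive, order, eq_comm]

theorem rank_ask_lt_rank_bid {a b : Order} : (ask a).rank < (bid b).rank ↔ Tradable b a := by
  simp only [rank_lt_rank_iff, turn, Sum.Lex.inl_lt_inr, and_true, ← le_iff_lt_or_eq]
  rfl

theorem rank_ask_ne_rank_bid {a b : Order} : (ask a).rank ≠ (bid b).rank := fun h =>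
  (rank_ask_lt_rank_bid.2 (price_le_of_rank_le h.le)).ne h

/-- The orders in `L`, put on the side `f` of the order book and weighted by their quantities. -/
def items (f : Order → Key) (L : List Order) : List (ℕ × Key) := L.map fun o => (o.qty, f o)

theorem mem_items {f : Order → Key} {L : List Order} {y : ℕ × Key} :
    y ∈ items f L ↔ ∃ o ∈ L, (o.qty, f o) = y := List.mem_map

theorem length_items (f : Order → Key) (L : List Order) : (items f L).length = L.length :=
  List.length_map _

theorem map_order_items_ask (A : List Order) : (items ask A).map (fun y => y.2.order) = A := by
  simp [items, Function.comp_def, order]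

theorem map_order_items_bid (B : List Order) : (items bid B).map (fun y => y.2.order) = B := by
  simp [items, Function.comp_def, order]

theorem nodup_rank_items {f : Order → Key} {L : List Order} (h : (L.map Order.timestamp).Nodup)
    (hf : ∀ o₁ o₂, (f o₁).turn = (f o₂).turn → o₁.timestamp = o₂.timestamp) :
    ((items f L).map fun y => y.2.rank).Nodup := by
  simp only [items, List.map_map, List.Nodup, List.pairwise_map] at h ⊢
  exact h.imp fun hne he => hne (hf _ _ (congrArg (fun r => (ofLex r).2) he))

theorem nodup_rank_items_ask {A : List Order} (h : (A.map Order.timestamp).Nodup) :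
    ((items ask A).map fun y => y.2.rank).Nodup :=
  nodup_rank_items h fun _ _ e => Sum.inl_injective e

theorem nodup_rank_items_bid {B : List Order} (h : (B.map Order.timestamp).Nodup) :
    ((items bid B).map fun y => y.2.rank).Nodup :=
  nodup_rank_items h fun _ _ e => Sum.inr_injective e

/-! ### Pairing bids with asks -/

/-- Trade the bids `Bs` with the asks `As`, in the given order, at the price `p`. -/
def pairUp (p : ℕ) : List (ℕ × Key) → List (ℕ × Key) → List Transaction
  | b :: Bs, a :: As =>
    if b.1 ≤ a.1 then ⟨b.2.order, a.2.order, b.1, p⟩ :: pairUp p Bs ((a.1 - b.1, a.2) :: As)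
    else ⟨b.2.order, a.2.order, a.1, p⟩ :: pairUp p ((b.1 - a.1, b.2) :: Bs) As
  | [], _ => []
  | _ :: _, [] => []
termination_by Bs As => Bs.length + As.length

section PairUp

variable {p : ℕ} {Bs As : List (ℕ × Key)}

theorem mem_of_mem_pairUp {m : Transaction} (hm : m ∈ pairUp p Bs As) :
    m.bid ∈ Bs.map (·.2.order) ∧ m.ask ∈ As.map (·.2.order) ∧ m.price = p := by
  fun_induction pairUp p Bs As <;> grind

theorem nodup_pairUp (hB : (Bs.map (·.2.order)).Nodup) (hA : (As.map (·.2.order)).Nodup) :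
    (pairUp p Bs As).Nodup := by
  fun_induction pairUp p Bs As with
  | case1 b Bs a As _ ih =>
    obtain ⟨hb, hB⟩ := List.nodup_cons.1 hB
    exact List.nodup_cons.2 ⟨fun hm => hb (mem_of_mem_pairUp hm).1, ih hB hA⟩
  | case2 b Bs a As _ ih =>
    obtain ⟨ha, hA⟩ := List.nodup_cons.1 hA
    exact List.nodup_cons.2 ⟨fun hm => ha (mem_of_mem_pairUp hm).2.1, ih hB hA⟩
  | case3 => exact .nil
  | case4 => exact .nil

theorem sum_fst_mul_eq_zero {L : List (ℕ × Key)} (h : weight L = 0) (f : Order → ℕ) :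
    (L.map fun y => y.1 * f y.2.order).sum = 0 := by
  simp only [weight, List.sum_eq_zero_iff, List.forall_mem_map] at h ⊢
  exact fun y hy => by rw [h y hy, zero_mul]

theorem sum_qty_mul_pairUp (f g : Order → ℕ) (h : weight Bs = weight As) :
    ((pairUp p Bs As).map fun m => m.qty * (f m.bid + g m.ask)).sum =
      (Bs.map fun y => y.1 * f y.2.order).sum + (As.map fun y => y.1 * g y.2.order).sum := by
  fun_induction pairUp p Bs As with
  | case1 b Bs a As hab ih =>
    simp only [weight_cons] at h ih
    simp only [List.map_cons, List.sum_cons, ih (by omega)]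
    obtain ⟨c, hc⟩ := Nat.exists_eq_add_of_le hab
    rw [hc, Nat.add_sub_cancel_left]
    ring
  | case2 b Bs a As hab ih =>
    simp only [weight_cons] at h ih
    simp only [List.map_cons, List.sum_cons, ih (by omega)]
    obtain ⟨c, hc⟩ := Nat.exists_eq_add_of_le (not_le.1 hab).le
    rw [hc, Nat.add_sub_cancel_left]
    ring
  | case3 As => simp [sum_fst_mul_eq_zero h.symm]
  | case4 b Bs => exact (sum_fst_mul_eq_zero h f).symm

theorem volume_pairUp (h : weight Bs = weight As) : volume (pairUp p Bs As) = weight Bs := by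
  simpa [volume, weight] using sum_qty_mul_pairUp (p := p) (fun _ => 1) (fun _ => 0) h

theorem weight_filter_order_eq (w : Order) (L : List (ℕ × Key)) :
    weight (L.filter fun y => y.2.order = w) =
      (L.map fun y => y.1 * if y.2.order = w then 1 else 0).sum := by
  induction L with
  | nil => rfl
  | cons y L ih =>
    by_cases h : y.2.order = w <;> simp [weight_cons, h, ih]

theorem tradedQty_eq_sum {M : List Transaction} (hM : ∀ m ∈ M, m.bid ≠ m.ask) (w : Order) :
    tradedQty w M = (M.map fun m =>
      m.qty * ((if m.bid = w then 1 else 0) + if m.ask = w then 1 else 0)).sum := by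
  induction M with
  | nil => rfl
  | cons m M ih =>
    obtain ⟨hm, hM⟩ := List.forall_mem_cons.1 hM
    rw [List.map_cons, List.sum_cons, ← ih hM]
    grind [tradedQty]

theorem tradedQty_pairUp (h : weight Bs = weight As)
    (hd : ((Bs ++ As).map (·.2.order)).Nodup) (w : Order) :
    tradedQty w (pairUp p Bs As) = weight ((Bs ++ As).filter fun y => y.2.order = w) := by
  rw [List.map_append] at hd
  have hM : ∀ m ∈ pairUp p Bs As, m.bid ≠ m.ask := fun m hm e =>
    List.disjoint_of_nodup_append hd (mem_of_mem_pairUp hm).1 (e ▸ (mem_of_mem_pairUp hm).2.1)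
  rw [tradedQty_eq_sum hM, List.filter_append, weight_append, weight_filter_order_eq,
    weight_filter_order_eq]
  exact sum_qty_mul_pairUp (fun o => if o = w then 1 else 0) (fun o => if o = w then 1 else 0) h

end PairUp

theorem volume_le_weight {L : List (ℕ × Key)} {M : List Transaction}
    (h : ∀ m ∈ M, ∃ y ∈ L, m.bid = y.2.order ∨ m.ask = y.2.order)
    (hL : ∀ y ∈ L, tradedQty y.2.order M ≤ y.1) : volume M ≤ weight L := by
  refine le_trans ?_ (List.sum_le_sum hL)
  clear hL
  induction M with
  | nil => exact Nat.zero_le _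
  | cons m M ih =>
    obtain ⟨⟨y, hy, hm⟩, h⟩ := List.forall_mem_cons.1 h
    have hcons (w : Order) : tradedQty w (m :: M) =
        (if m.bid = w ∨ m.ask = w then m.qty else 0) + tradedQty w M := by
      grind [tradedQty]
    simp only [hcons, List.sum_map_add]
    refine add_le_add (le_trans ?_ (List.le_sum_of_mem (List.mem_map_of_mem hy))) (ih h)
    rw [if_pos hm]

/-! ### Clearing the book at an entry -/

theorem IsMatching.volume_le_weight_below {B A : List Order} {M : List Transaction}
    (hM : IsMatching B A M) {x : Key} (h : ∀ m ∈ M, (ask m.ask).rank < x.rank) :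
    volume M ≤ weight (below rank x (items ask A)) := by
  refine volume_le_weight (fun m hm => ⟨(m.ask.qty, ask m.ask), ?_, .inr rfl⟩) fun y hy => ?_
  · exact mem_below.2 ⟨mem_items.2 ⟨_, hM.ask_mem m hm, rfl⟩, h m hm⟩
  · obtain ⟨a, ha, rfl⟩ := mem_items.1 (mem_below.1 hy).1
    exact hM.qty_le a (List.mem_append_right _ ha)

theorem IsMatching.volume_le_weight_above {B A : List Order} {M : List Transaction}
    (hM : IsMatching B A M) {x : Key} (h : ∀ m ∈ M, x.rank < (bid m.bid).rank) :
    volume M ≤ weight (above rank x (items bid B)) := by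
  refine volume_le_weight (fun m hm => ⟨(m.bid.qty, bid m.bid), ?_, .inl rfl⟩) fun y hy => ?_
  · exact mem_above.2 ⟨mem_items.2 ⟨_, hM.bid_mem m hm, rfl⟩, h m hm⟩
  · obtain ⟨b, hb, rfl⟩ := mem_items.1 (mem_above.1 hy).1
    exact hM.qty_le b (List.mem_append_left _ hb)

open OrderDual in
/-- `Bs` and `As` list the quantities to be traded when the book of `B` and `A` is cleared at its
entry `x`: every bid above `x` and every ask below `x` trades in full, and `x` itself makes up for
the difference. -/
structure IsAllocation (B A : List Order) (x : Key) (Bs As : List (ℕ × Key)) : Prop where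
  bids : IsTruncation (toDual ∘ rank) x (items bid B) Bs
  asks : IsTruncation rank x (items ask A) As
  weight_eq : weight Bs = weight As

namespace IsAllocation

variable {B A : List Order} {x : Key} {Bs As : List (ℕ × Key)} {p : ℕ}

theorem exists_of_mem_bids (h : IsAllocation B A x Bs As) {y : ℕ × Key} (hy : y ∈ Bs) :
    ∃ b ∈ B, bid b = y.2 ∧ y.1 ≤ b.qty ∧ x.rank ≤ (bid b).rank := by
  obtain ⟨z, hz, hzy, hle⟩ := h.bids.exists_mem y hy
  obtain ⟨b, hb, rfl⟩ := mem_items.1 hz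
  have hby : bid b = y.2 := hzy
  exact ⟨b, hb, hby, hle, hby ▸ h.bids.rank_le y hy⟩

theorem exists_of_mem_asks (h : IsAllocation B A x Bs As) {y : ℕ × Key} (hy : y ∈ As) :
    ∃ a ∈ A, ask a = y.2 ∧ y.1 ≤ a.qty ∧ (ask a).rank ≤ x.rank := by
  obtain ⟨z, hz, hzy, hle⟩ := h.asks.exists_mem y hy
  obtain ⟨a, ha, rfl⟩ := mem_items.1 hz
  have hay : ask a = y.2 := hzy
  exact ⟨a, ha, hay, hle, hay ▸ h.asks.rank_le y hy⟩

theorem subperm (h : IsAllocation B A x Bs As) :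
    ((Bs ++ As).map (·.2.order)).Subperm (B ++ A) := by
  obtain ⟨l, hl, hs⟩ := h.bids.subperm.append h.asks.subperm
  rw [← map_order_items_bid B, ← map_order_items_ask A]
  exact ⟨l.map Key.order, by simpa [Function.comp_def] using hl.map Key.order,
    by simpa [Function.comp_def] using hs.map Key.order⟩

theorem nodup (h : IsAllocation B A x Bs As) (hd : (B ++ A).Nodup) :
    ((Bs ++ As).map (·.2.order)).Nodup := by
  obtain ⟨l, hl, hs⟩ := h.subperm
  exact hl.nodup (hd.sublist hs)

theorem tradedQty_of_mem (h : IsAllocation B A x Bs As) (hd : (B ++ A).Nodup) {y : ℕ × Key}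
    (hy : y ∈ Bs ++ As) : tradedQty y.2.order (pairUp p Bs As) = y.1 := by
  rw [tradedQty_pairUp h.weight_eq (h.nodup hd)]
  exact weight_filter_eq_of_mem (h.nodup hd) hy

theorem exists_mem_of_tradedQty_pos (h : IsAllocation B A x Bs As) (hd : (B ++ A).Nodup)
    {w : Order} (hw : 1 ≤ tradedQty w (pairUp p Bs As)) : ∃ y ∈ Bs ++ As, y.2.order = w := by
  by_contra! hne
  rw [tradedQty_pairUp h.weight_eq (h.nodup hd),
    List.filter_eq_nil_iff.2 (by simpa only [decide_eq_true_eq] using hne)] at hw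
  exact absurd hw (by decide)

theorem tradedQty_le (h : IsAllocation B A x Bs As) (hd : (B ++ A).Nodup) (w : Order) :
    tradedQty w (pairUp p Bs As) ≤ w.qty := by
  rcases Nat.eq_zero_or_pos (tradedQty w (pairUp p Bs As)) with hw | hw
  · exact hw ▸ Nat.zero_le _
  obtain ⟨y, hy, rfl⟩ := h.exists_mem_of_tradedQty_pos hd hw
  rw [h.tradedQty_of_mem hd hy]
  rcases List.mem_append.1 hy with hy | hy
  · obtain ⟨b, -, hb, hle, -⟩ := h.exists_of_mem_bids hy
    exact hb ▸ hle
  · obtain ⟨a, -, ha, hle, -⟩ := h.exists_of_mem_asks hy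
    exact ha ▸ hle

theorem isMatching (h : IsAllocation B A x Bs As) (hd : (B ++ A).Nodup) :
    IsMatching B A (pairUp x.order.price Bs As) := by
  have hbid : ∀ m ∈ pairUp x.order.price Bs As, m.bid ∈ B ∧ m.price ≤ m.bid.price := by
    intro m hm
    obtain ⟨y, hy, hym⟩ := List.mem_map.1 (mem_of_mem_pairUp hm).1
    obtain ⟨b, hb, hby, -, hle⟩ := h.exists_of_mem_bids hy
    rw [← hym, ← hby, (mem_of_mem_pairUp hm).2.2]
    exact ⟨hb, price_le_of_rank_le hle⟩
  have hask : ∀ m ∈ pairUp x.order.price Bs As, m.ask ∈ A ∧ m.ask.price ≤ m.price := by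
    intro m hm
    obtain ⟨y, hy, hym⟩ := List.mem_map.1 (mem_of_mem_pairUp hm).2.1
    obtain ⟨a, ha, hay, -, hle⟩ := h.exists_of_mem_asks hy
    rw [← hym, ← hay, (mem_of_mem_pairUp hm).2.2]
    exact ⟨ha, price_le_of_rank_le hle⟩
  exact
    { bid_mem := fun m hm => (hbid m hm).1
      ask_mem := fun m hm => (hask m hm).1
      tradable := fun m hm => (hask m hm).2.trans (hbid m hm).2
      ask_price_le := fun m hm => (hask m hm).2
      price_le_bid := fun m hm => (hbid m hm).2
      qty_le := fun w _ => h.tradedQty_le hd w }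

theorem fairOnBids (h : IsAllocation B A x Bs As) (hd : (B ++ A).Nodup) :
    FairOnBids B (pairUp p Bs As) := by
  intro b₁ hb₁ b₂ hb₂ hlt hpos
  have hx : x.rank ≤ (bid b₂).rank := by
    obtain ⟨y, hy, rfl⟩ := h.exists_mem_of_tradedQty_pos hd hpos
    rcases List.mem_append.1 hy with hy | hy
    · obtain ⟨b, -, hb, -, hle⟩ := h.exists_of_mem_bids hy
      exact hb ▸ hle
    · obtain ⟨a, ha, hay, -⟩ := h.exists_of_mem_asks hy
      exact absurd (hay ▸ ha) (List.disjoint_of_nodup_append hd hb₂)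
  have hmem : (b₁.qty, bid b₁) ∈ Bs := h.bids.below_sublist.subset
    (mem_below.2 ⟨mem_items.2 ⟨b₁, hb₁, rfl⟩, hx.trans_lt (rank_bid_lt_rank_bid.2 hlt)⟩)
  exact h.tradedQty_of_mem hd (List.mem_append_left _ hmem)

theorem fairOnAsks (h : IsAllocation B A x Bs As) (hd : (B ++ A).Nodup) :
    FairOnAsks A (pairUp p Bs As) := by
  intro a₁ ha₁ a₂ ha₂ hlt hpos
  have hx : (ask a₂).rank ≤ x.rank := by
    obtain ⟨y, hy, rfl⟩ := h.exists_mem_of_tradedQty_pos hd hpos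
    rcases List.mem_append.1 hy with hy | hy
    · obtain ⟨b, hb, hby, -⟩ := h.exists_of_mem_bids hy
      exact absurd ha₂ (List.disjoint_of_nodup_append hd (hby ▸ hb))
    · obtain ⟨a, -, ha, -, hle⟩ := h.exists_of_mem_asks hy
      exact ha ▸ hle
  have hmem : (a₁.qty, ask a₁) ∈ As := h.asks.below_sublist.subset
    (mem_below.2 ⟨mem_items.2 ⟨a₁, ha₁, rfl⟩, (rank_ask_lt_rank_ask.2 hlt).trans_le hx⟩)
  exact h.tradedQty_of_mem hd (List.mem_append_right _ hmem)

/-- If some ask at or above `x` can trade at the common price `q` of the competing matching, then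
every bid that trades at `q` is above that ask; otherwise every ask that trades is below `x`. -/
theorem volume_le (h : IsAllocation B A x Bs As) {M : List Transaction} (hM : IsMatching B A M)
    (hu : IsUniform M) : volume M ≤ volume (pairUp p Bs As) := by
  obtain ⟨q, hq⟩ := hu
  rw [volume_pairUp h.weight_eq]
  by_cases hx : ∃ a : Order, a.price ≤ q ∧ x.rank ≤ (ask a).rank
  · obtain ⟨a, haq, hxa⟩ := hx
    refine (hM.volume_le_weight_above fun m hm => hxa.trans_lt (rank_ask_lt_rank_bid.2 ?_)).trans
      (weight_le_of_sublist h.bids.below_sublist)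
    exact haq.trans (hq m hm ▸ hM.price_le_bid m hm)
  · push Not at hx
    rw [h.weight_eq]
    exact (hM.volume_le_weight_below fun m hm => hx _ (hq m hm ▸ hM.ask_price_le m hm)).trans
      (weight_le_of_sublist h.asks.below_sublist)

end IsAllocation

/-- The bids traded when the book of `B` and `A` is cleared at its entry `x`. -/
def tradedBids (x : Key) (B A : List Order) : List (ℕ × Key) :=
  match x with
  | ask _ => above rank x (items bid B)
  | bid _ => (weight (below rank x (items ask A)) - weight (above rank x (items bid B)), x) ::
      above rank x (items bid B)

/-- The asks traded when the book of `B` and `A` is cleared at its entry `x`. -/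
def tradedAsks (x : Key) (B A : List Order) : List (ℕ × Key) :=
  match x with
  | ask _ => (weight (above rank x (items bid B)) - weight (below rank x (items ask A)), x) ::
      below rank x (items ask A)
  | bid _ => below rank x (items ask A)

open OrderDual in
theorem isAllocation_of_isSplit {B A : List Order} (hB : (B.map Order.timestamp).Nodup)
    (hA : (A.map Order.timestamp).Nodup) {y : ℕ × Key} (hy : y ∈ items bid B ++ items ask A)
    (hs : IsSplit rank y.2 (weight (items bid B)) (weight (items ask A))
      (items bid B ++ items ask A)) :
    IsAllocation B A y.2 (tradedBids y.2 B A) (tradedAsks y.2 B A) := by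
  rcases List.mem_append.1 hy with hy | hy
  · obtain ⟨b, -, rfl⟩ := mem_items.1 hy
    have hne : ∀ z ∈ items ask A, toDual z.2.rank ≠ toDual (bid b).rank := by
      intro z hz
      obtain ⟨a, -, rfl⟩ := mem_items.1 hz
      exact rank_ask_ne_rank_bid
    have hle := weight_below_le_and_weight_above_le (r := toDual ∘ rank) hy
      (nodup_rank_items_bid hB) hne (hs.perm List.perm_append_comm).dual
    refine ⟨isTruncation_cons _ hy (Nat.sub_le_iff_le_add'.2 hle.2), isTruncation_below .., ?_⟩
    exact (weight_cons ..).trans (Nat.sub_add_cancel hle.1)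
  · obtain ⟨a, -, rfl⟩ := mem_items.1 hy
    have hne : ∀ z ∈ items bid B, z.2.rank ≠ (ask a).rank := by
      intro z hz
      obtain ⟨b, -, rfl⟩ := mem_items.1 hz
      exact rank_ask_ne_rank_bid.symm
    have hle := weight_below_le_and_weight_above_le hy (nodup_rank_items_ask hA) hne hs
    refine ⟨isTruncation_below .., isTruncation_cons _ hy (Nat.sub_le_iff_le_add'.2 hle.2), ?_⟩
    exact ((weight_cons ..).trans (Nat.sub_add_cancel hle.1)).symm

/-! ### Evaluation within a time bound -/

/-- `Runs F ρ e v T`: with the function bodies `F` and in the environment `ρ`, the evaluation of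
`e` halts with the value `v` within `T` units of time. -/
def Runs (F : List Expr) (ρ : List Val) (e : Expr) (v : Val) (T : ℕ) : Prop :=
  ∃ t ≤ T, Eval F ρ e v t

namespace Runs

variable {F : List Expr} {ρ : List Val} {e e₁ e₂ l r : Expr} {v v' w : Val} {m n s s' t : ℕ}

theorem mono : Runs F ρ e v s → s ≤ t → Runs F ρ e v t
  | ⟨_, hs, h⟩, hst => ⟨_, hs.trans hst, h⟩

theorem var {i : ℕ} (h : ρ[i]? = some v) : Runs F ρ (.var i) v 1 := ⟨_, le_rfl, .var h⟩

theorem nil : Runs F ρ .nil .nil 1 := ⟨_, le_rfl, .nil⟩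

theorem num : Runs F ρ (.num n) (.nat n) 1 := ⟨_, le_rfl, .num⟩

theorem add : Runs F ρ e₁ (.nat m) s → Runs F ρ e₂ (.nat n) t →
    Runs F ρ (.add e₁ e₂) (.nat (m + n)) (s + t + 1)
  | ⟨_, hs, h₁⟩, ⟨_, ht, h₂⟩ => ⟨_, by omega, .add h₁ h₂⟩

theorem sub : Runs F ρ e₁ (.nat m) s → Runs F ρ e₂ (.nat n) t →
    Runs F ρ (.sub e₁ e₂) (.nat (m - n)) (s + t + 1)
  | ⟨_, hs, h₁⟩, ⟨_, ht, h₂⟩ => ⟨_, by omega, .sub h₁ h₂⟩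

theorem pair : Runs F ρ e₁ v s → Runs F ρ e₂ w t →
    Runs F ρ (.pair e₁ e₂) (.pair v w) (s + t + 1)
  | ⟨_, hs, h₁⟩, ⟨_, ht, h₂⟩ => ⟨_, by omega, .pair h₁ h₂⟩

theorem fst : Runs F ρ e (.pair v w) t → Runs F ρ (.fst e) v (t + 1)
  | ⟨_, ht, h⟩ => ⟨_, by omega, .fst h⟩

theorem snd : Runs F ρ e (.pair v w) t → Runs F ρ (.snd e) w (t + 1)
  | ⟨_, ht, h⟩ => ⟨_, by omega, .snd h⟩

theorem bind : Runs F ρ e₁ v s → Runs F (v :: ρ) e₂ w t → Runs F ρ (.bind e₁ e₂) w (s + t + 1)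
  | ⟨_, hs, h₁⟩, ⟨_, ht, h₂⟩ => ⟨_, by omega, .bind h₁ h₂⟩

theorem ifNil_nil : Runs F ρ e .nil s → Runs F ρ e₁ w t →
    Runs F ρ (.ifNil e e₁ e₂) w (s + t + 1)
  | ⟨_, hs, h₁⟩, ⟨_, ht, h₂⟩ => ⟨_, by omega, .ifNil_nil h₁ h₂⟩

theorem ifNil_pair : Runs F ρ e (.pair v v') s → Runs F ρ e₂ w t →
    Runs F ρ (.ifNil e e₁ e₂) w (s + t + 1)
  | ⟨_, hs, h₁⟩, ⟨_, ht, h₂⟩ => ⟨_, by omega, .ifNil_pair h₁ h₂⟩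

theorem ifNatLe_le : Runs F ρ l (.nat m) s → Runs F ρ r (.nat n) s' → m ≤ n → Runs F ρ e₁ w t →
    Runs F ρ (.ifNatLe l r e₁ e₂) w (s + s' + t + 1)
  | ⟨_, hs, h₁⟩, ⟨_, hs', h₂⟩, h, ⟨_, ht, h₃⟩ => ⟨_, by omega, .ifNatLe_le h₁ h₂ h h₃⟩

theorem ifNatLe_gt : Runs F ρ l (.nat m) s → Runs F ρ r (.nat n) s' → n < m → Runs F ρ e₂ w t →
    Runs F ρ (.ifNatLe l r e₁ e₂) w (s + s' + t + 1)
  | ⟨_, hs, h₁⟩, ⟨_, hs', h₂⟩, h, ⟨_, ht, h₃⟩ => ⟨_, by omega, .ifNatLe_gt h₁ h₂ h h₃⟩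

theorem ifPriceLe_le : Runs F ρ l (.price m) s → Runs F ρ r (.price n) s' → m ≤ n →
    Runs F ρ e₁ w t → Runs F ρ (.ifPriceLe l r e₁ e₂) w (s + s' + t + 1)
  | ⟨_, hs, h₁⟩, ⟨_, hs', h₂⟩, h, ⟨_, ht, h₃⟩ => ⟨_, by omega, .ifPriceLe_le h₁ h₂ h h₃⟩

theorem ifPriceLe_gt : Runs F ρ l (.price m) s → Runs F ρ r (.price n) s' → n < m →
    Runs F ρ e₂ w t → Runs F ρ (.ifPriceLe l r e₁ e₂) w (s + s' + t + 1)
  | ⟨_, hs, h₁⟩, ⟨_, hs', h₂⟩, h, ⟨_, ht, h₃⟩ => ⟨_, by omega, .ifPriceLe_gt h₁ h₂ h h₃⟩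

theorem call {f : ℕ} {body : Expr} (hf : F[f]? = some body) :
    Runs F ρ e v s → Runs F [v] body w t → Runs F ρ (.call f e) w (s + t + 1)
  | ⟨_, hs, h₁⟩, ⟨_, ht, h₂⟩ => ⟨_, by omega, .call hf h₁ h₂⟩

end Runs

/-! ### The program -/

/-- The side of an entry as a datum: the empty list for an ask, a cons cell for a bid. -/
def Key.tag : Key → Val
  | ask _ => .nil
  | bid _ => .pair .nil .nil

/-- An entry of the order book as a datum. -/
def encodeKey (x : Key) : Val := .pair x.tag (encodeOrder x.order)

/-- A weighted entry of the order book as a datum. -/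
def encodeItem (y : ℕ × Key) : Val := .pair (.nat y.1) (encodeKey y.2)

namespace Code

open Exchange.Expr

/-- The quantity of an order. -/
def qty (o : Expr) : Expr := fst (snd (snd o))

/-- The side of an entry. -/
def tag (x : Expr) : Expr := fst x

/-- The id of an entry. -/
def id (x : Expr) : Expr := fst (snd x)

/-- The timestamp of an entry. -/
def timestamp (x : Expr) : Expr := fst (snd (snd x))

/-- The limit price of an entry. -/
def price (x : Expr) : Expr := snd (snd (snd (snd x)))

/-- If the turn of the entry `x` is at most that of `y` then `e₁` else `e₂`. -/
def ifTurnLe (x y e₁ e₂ : Expr) : Expr :=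
  ifNil (tag x)
    (ifNil (tag y) (ifNatLe (timestamp x) (timestamp y) e₁ e₂) e₁)
    (ifNil (tag y) e₂ (ifNatLe (timestamp y) (timestamp x) e₁ e₂))

/-- If the rank of the entry `x` is at most that of `y` then `e₁` else `e₂`. -/
def ifRankLe (x y e₁ e₂ : Expr) : Expr :=
  ifPriceLe (price x) (price y) (ifPriceLe (price y) (price x) (ifTurnLe x y e₁ e₂) e₁) e₂

/-- The median of three entries. -/
def median (x y z : Expr) : Expr :=
  ifRankLe x y (ifRankLe y z y (ifRankLe x z z x)) (ifRankLe x z x (ifRankLe y z z y))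

/-- The medians of the consecutive triples of a list. -/
def medians (L : Expr) : Expr := call 0 L

/-- The entries of a list that are ranked before `x`, together with those ranked after `x`. -/
def partition (x L : Expr) : Expr := call 1 (pair x L)

/-- The total weight of a list. -/
def weight (L : Expr) : Expr := call 2 L

/-- The length of a list. -/
def length (L : Expr) : Expr := call 3 L

/-- An entry that splits the list `L` at `k` units from the bottom and `l` units from the top. -/
def select (L k l : Expr) : Expr := call 4 (pair L (pair k l))

/-- The weighted entries of the orders in `L` with the side `tag`, in front of the list `R`. -/
def items (tag L R : Expr) : Expr := call 5 (pair tag (pair L R))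

/-- The transactions, at the price `p`, of the bids `Bs` with the asks `As`. -/
def pairUp (p Bs As : Expr) : Expr := call 6 (pair p (pair Bs As))

/-- The function behind `medians`. -/
def mediansBody : Expr :=
  let L := var 0
  ifNil L nil <| ifNil (snd L) nil <| ifNil (snd (snd L)) nil <|
  pair (pair (num 2) (median (snd (fst L)) (snd (fst (snd L))) (snd (fst (snd (snd L))))))
    (medians (snd (snd (snd L))))

/-- The function behind `partition`. -/
def partitionBody : Expr :=
  let L := snd (var 0)
  ifNil L (pair nil nil) <|
  bind (partition (fst (var 0)) (snd L)) <|
  let belows := fst (var 0)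
  let aboves := snd (var 0)
  let x := fst (var 1)
  let y := fst (snd (var 1))
  ifRankLe x (snd y)
    (ifRankLe (snd y) x (pair belows aboves) (pair belows (pair y aboves)))
    (pair (pair y belows) aboves)

/-- The function behind `weight`. -/
def weightBody : Expr :=
  let L := var 0
  ifNil L (num 0) (add (fst (fst L)) (weight (snd L)))

/-- The function behind `length`. -/
def lengthBody : Expr :=
  let L := var 0
  ifNil L (num 0) (add (length (snd L)) (num 1))

/-- The median of the medians of medians `M` of `L`, or the first entry of `L` if `M` is empty. -/
def pivot (M L : Expr) : Expr := ifNil M (snd (fst L)) (select M (length M) (length M))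

/-- Selection in a list with the parts `belows` and `aboves` on the two sides of `pivot`. -/
def descend (belows pivot aboves k l : Expr) : Expr :=
  ifNatLe (weight belows) k
    (ifNatLe (weight aboves) l pivot (select aboves (sub (weight aboves) l) l))
    (select belows k (sub (weight belows) k))

/-- The function behind `select`. -/
def selectBody : Expr :=
  bind (medians (medians (fst (var 0)))) <|
  bind (pivot (var 0) (fst (var 1))) <|
  bind (partition (var 0) (fst (var 2))) <|
  descend (fst (var 0)) (var 1) (snd (var 0)) (fst (snd (var 3))) (snd (snd (var 3)))

/-- The function behind `items`. -/
def itemsBody : Expr :=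
  let tag := fst (var 0)
  let L := fst (snd (var 0))
  let R := snd (snd (var 0))
  ifNil L R (pair (pair (qty (fst L)) (pair tag (fst L))) (items tag (snd L) R))

/-- A transaction of `q` units at the price `p`. -/
def transaction (b a q p : Expr) : Expr := pair (id b) (pair (id a) (pair q p))

/-- The function behind `pairUp`. -/
def pairUpBody : Expr :=
  let p := fst (var 0)
  let Bs := fst (snd (var 0))
  let As := snd (snd (var 0))
  let b := fst Bs
  let a := fst As
  ifNil Bs nil <| ifNil As nil <|
  ifNatLe (fst b) (fst a)
    (pair (transaction (snd b) (snd a) (fst b) p)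
      (pairUp p (snd Bs) (pair (pair (sub (fst a) (fst b)) (snd a)) (snd As))))
    (pair (transaction (snd b) (snd a) (fst a) p)
      (pairUp p (pair (pair (sub (fst b) (fst a)) (snd b)) (snd Bs)) (snd As)))

/-- The functions of the program. -/
def funs : List Expr :=
  [mediansBody, partitionBody, weightBody, lengthBody, selectBody, itemsBody, pairUpBody]

/-- The transactions when the book is cleared at its entry `x`, with the bids `Bs` above `x` and
the asks `As` below `x`. -/
def settle (x Bs As : Expr) : Expr :=
  ifNil (tag x)
    (pairUp (price x) Bs (pair (pair (sub (weight Bs) (weight As)) x) As))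
    (pairUp (price x) (pair (pair (sub (weight As) (weight Bs)) x) Bs) As)

/-- The transactions when the book `var 0` of the asks `var 1` and the bids `var 2` is cleared. -/
def clear : Expr :=
  bind (select (var 0) (weight (var 2)) (weight (var 1))) <|
  bind (snd (partition (var 0) (var 3))) <|
  bind (fst (partition (var 1) (var 3))) <|
  settle (var 2) (var 1) (var 0)

/-- The main expression of the program. -/
def main : Expr :=
  let bidTag := pair nil nil
  let askTag := nil
  bind (items bidTag (fst (var 0)) nil) <|
  bind (items askTag (snd (var 1)) nil) <|
  bind (items bidTag (fst (var 2)) (var 0)) <|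
  ifNil (var 0) nil clear

end Code

/-! ### Running time of the program -/

section Correctness

variable {F : List Expr} {ρ : List Val} {e e' e'' e₁ e₂ : Expr} {v w : Val} {x y z : Key}
  {s s' t t' : ℕ}

theorem runs_ifTurnLe (hx : Runs F ρ e (encodeKey x) s) (hy : Runs F ρ e' (encodeKey y) s')
    (h₁ : Runs F ρ e₁ v t) (h₂ : Runs F ρ e₂ w t') :
    Runs F ρ (Code.ifTurnLe e e' e₁ e₂) (if x.turn ≤ y.turn then v else w)
      (2 * s + 2 * s' + t + t' + 20) := by
  match x, y with
  | ask a, ask a' =>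
    refine .mono (.ifNil_nil (.fst hx) (.ifNil_nil (.fst hy) ?_ (t := s + s' + t + t' + 10)))
      (by omega)
    simp only [turn, Sum.Lex.inl_le_inl_iff]
    split_ifs with h
    · exact .mono (.ifNatLe_le (.fst <| .snd <| .snd hx) (.fst <| .snd <| .snd hy) h h₁) (by omega)
    · exact .mono (.ifNatLe_gt (.fst <| .snd <| .snd hx) (.fst <| .snd <| .snd hy) (not_le.1 h) h₂)
        (by omega)
  | ask a, bid b =>
    rw [if_pos (Sum.Lex.inl_lt_inr ..).le]
    exact .mono (.ifNil_nil (.fst hx) (.ifNil_pair (.fst hy) h₁)) (by omega)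
  | bid b, ask a =>
    rw [if_neg (c := (bid b).turn ≤ (ask a).turn) Sum.Lex.not_inr_le_inl]
    exact .mono (.ifNil_pair (.fst hx) (.ifNil_nil (.fst hy) h₂)) (by omega)
  | bid b, bid b' =>
    refine .mono (.ifNil_pair (.fst hx) (.ifNil_pair (.fst hy) ?_ (t := s + s' + t + t' + 10)))
      (by omega)
    simp only [turn, Sum.Lex.inr_le_inr_iff, OrderDual.toDual_le_toDual]
    split_ifs with h
    · exact .mono (.ifNatLe_le (.fst <| .snd <| .snd hy) (.fst <| .snd <| .snd hx) h h₁) (by omega)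
    · exact .mono (.ifNatLe_gt (.fst <| .snd <| .snd hy) (.fst <| .snd <| .snd hx) (not_le.1 h) h₂)
        (by omega)

theorem runs_price (hx : Runs F ρ e (encodeKey x) s) :
    Runs F ρ (Code.price e) (.price x.order.price) (s + 4) := .snd <| .snd <| .snd <| .snd hx

theorem runs_ifRankLe (hx : Runs F ρ e (encodeKey x) s) (hy : Runs F ρ e' (encodeKey y) s')
    (h₁ : Runs F ρ e₁ v t) (h₂ : Runs F ρ e₂ w t') :
    Runs F ρ (Code.ifRankLe e e' e₁ e₂) (if x.rank ≤ y.rank then v else w)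
      (4 * s + 4 * s' + t + t' + 50) := by
  have hpx := runs_price hx
  have hpy := runs_price hy
  rcases lt_trichotomy x.order.price y.order.price with h | h | h
  · rw [if_pos (rank_le_rank_iff.2 (.inl h))]
    exact .mono (.ifPriceLe_le hpx hpy h.le (.ifPriceLe_gt hpy hpx h h₁)) (by omega)
  · simp only [rank_le_rank_iff, h, lt_irrefl, false_or, true_and]
    exact .mono (.ifPriceLe_le hpx hpy h.le
      (.ifPriceLe_le hpy hpx h.ge (runs_ifTurnLe hx hy h₁ h₂))) (by omega)
  · rw [if_neg fun hle => (price_le_of_rank_le hle).not_gt h]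
    exact .mono (.ifPriceLe_gt hpx hpy h h₂) (by omega)

theorem runs_median (hx : Runs F ρ e (encodeKey x) s) (hy : Runs F ρ e' (encodeKey y) s)
    (hz : Runs F ρ e'' (encodeKey z) s) :
    Runs F ρ (Code.median e e' e'') (encodeKey (median rank x y z)) (50 * s + 300) := by
  simp only [median, apply_ite encodeKey]
  exact .mono (runs_ifRankLe hx hy (runs_ifRankLe hy hz hy (runs_ifRankLe hx hz hz hx))
    (runs_ifRankLe hx hz hx (runs_ifRankLe hy hz hz hy))) (by omega)

open Code (funs)

theorem runs_medians {L : List (ℕ × Key)} (h : Runs funs ρ e (encodeList encodeItem L) t) :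
    Runs funs ρ (Code.medians e) (encodeList encodeItem (medians rank L))
      (t + 300 * L.length + 20) := by
  fun_induction medians rank L generalizing ρ e t with
  | case1 x y z L ih =>
    exact .mono (.call rfl h <| .ifNil_pair (.var rfl) <| .ifNil_pair (.snd <| .var rfl) <|
      .ifNil_pair (.snd <| .snd <| .var rfl) <| .pair (.pair .num
        (runs_median (s := 5) (.mono (.snd <| .fst <| .var rfl) (by omega))
          (.mono (.snd <| .fst <| .snd <| .var rfl) (by omega))
          (.snd <| .fst <| .snd <| .snd <| .var rfl)))
      (ih (.snd <| .snd <| .snd <| .var rfl))) (by simp only [List.length_cons]; omega)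
  | case2 L hL =>
    match L, hL with
    | [], _ => exact .mono (.call rfl h <| .ifNil_nil (.var rfl) .nil) (by omega)
    | [_], _ =>
      exact .mono (.call rfl h <| .ifNil_pair (.var rfl) <| .ifNil_nil (.snd <| .var rfl) .nil)
        (by omega)
    | [_, _], _ =>
      exact .mono (.call rfl h <| .ifNil_pair (.var rfl) <| .ifNil_pair (.snd <| .var rfl) <|
        .ifNil_nil (.snd <| .snd <| .var rfl) .nil) (by omega)
    | x :: y :: z :: L, hL => exact (hL x y z L rfl).elim

theorem encodeList_below_above_cons (x : Key) (y : ℕ × Key) (L : List (ℕ × Key)) :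
    Val.pair (encodeList encodeItem (below rank x (y :: L)))
        (encodeList encodeItem (above rank x (y :: L))) =
      if x.rank ≤ y.2.rank then
        if y.2.rank ≤ x.rank then
          .pair (encodeList encodeItem (below rank x L)) (encodeList encodeItem (above rank x L))
        else
          .pair (encodeList encodeItem (below rank x L))
            (.pair (encodeItem y) (encodeList encodeItem (above rank x L)))
      else
        .pair (.pair (encodeItem y) (encodeList encodeItem (below rank x L)))
          (encodeList encodeItem (above rank x L)) := by
  simp only [below, above, List.filter_cons, decide_eq_true_eq, ← not_le]
  grind [encodeList]

theorem runs_partition {L : List (ℕ × Key)} (hx : Runs funs ρ e (encodeKey x) s)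
    (hL : Runs funs ρ e' (encodeList encodeItem L) t) :
    Runs funs ρ (Code.partition e e')
      (.pair (encodeList encodeItem (below rank x L)) (encodeList encodeItem (above rank x L)))
      (s + t + 200 * L.length + 20) := by
  induction L generalizing ρ e e' s t with
  | nil =>
    exact .mono (.call rfl (.pair hx hL) <| .ifNil_nil (.snd <| .var rfl) <| .pair .nil .nil)
      (by omega)
  | cons y L ih =>
    rw [encodeList_below_above_cons]
    exact .mono (.call rfl (.pair hx hL) <| .ifNil_pair (.snd <| .var rfl) <|
      .bind (ih (.fst <| .var rfl) (.snd <| .snd <| .var rfl)) <|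
      runs_ifRankLe (.fst <| .var rfl) (.snd <| .fst <| .snd <| .var rfl)
        (runs_ifRankLe (.snd <| .fst <| .snd <| .var rfl) (.fst <| .var rfl)
          (.pair (.fst <| .var rfl) (.snd <| .var rfl))
          (.pair (.fst <| .var rfl) (.pair (.fst <| .snd <| .var rfl) (.snd <| .var rfl))))
        (.pair (.pair (.fst <| .snd <| .var rfl) (.fst <| .var rfl)) (.snd <| .var rfl)))
      (by simp only [List.length_cons]; omega)

theorem runs_weight {L : List (ℕ × Key)} (h : Runs funs ρ e (encodeList encodeItem L) t) :
    Runs funs ρ (Code.weight e) (.nat (weight L)) (t + 20 * L.length + 5) := by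
  induction L generalizing ρ e t with
  | nil => exact .mono (.call rfl h <| .ifNil_nil (.var rfl) .num) (by omega)
  | cons y L ih =>
    exact .mono (.call rfl h <| .ifNil_pair (.var rfl) <|
      .add (.fst <| .fst <| .var rfl) (ih (.snd <| .var rfl)))
      (by simp only [List.length_cons]; omega)

theorem runs_length {L : List (ℕ × Key)} (h : Runs funs ρ e (encodeList encodeItem L) t) :
    Runs funs ρ (Code.length e) (.nat L.length) (t + 20 * L.length + 5) := by
  induction L generalizing ρ e t with
  | nil => exact .mono (.call rfl h <| .ifNil_nil (.var rfl) .num) (by omega)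
  | cons y L ih =>
    exact .mono (.call rfl h <| .ifNil_pair (.var rfl) <| .add (ih (.snd <| .var rfl)) .num)
      (by simp only [List.length_cons]; omega)

theorem runs_items {f : Order → Key} (hf : ∀ o, encodeKey (f o) = .pair v (encodeOrder o))
    {L : List Order} {R : List (ℕ × Key)} (hv : Runs funs ρ e v s)
    (hL : Runs funs ρ e₁ (encodeList encodeOrder L) t)
    (hR : Runs funs ρ e₂ (encodeList encodeItem R) t') :
    Runs funs ρ (Code.items e e₁ e₂) (encodeList encodeItem (items f L ++ R))
      (s + t + t' + 50 * L.length + 20) := by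
  induction L generalizing ρ e e₁ e₂ s t t' with
  | nil =>
    exact .mono (.call rfl (.pair hv (.pair hL hR)) <| .ifNil_nil (.fst <| .snd <| .var rfl)
      (.snd <| .snd <| .var rfl)) (by omega)
  | cons o L ih =>
    have hcons : encodeList encodeItem (items f (o :: L) ++ R) =
        .pair (.pair (.nat o.qty) (.pair v (encodeOrder o)))
          (encodeList encodeItem (items f L ++ R)) := by
      rw [← hf]
      rfl
    rw [hcons]
    exact .mono (.call rfl (.pair hv (.pair hL hR)) <| .ifNil_pair (.fst <| .snd <| .var rfl) <|
      .pair (.pair (.fst <| .snd <| .snd <| .fst <| .fst <| .snd <| .var rfl)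
          (.pair (.fst <| .var rfl) (.fst <| .fst <| .snd <| .var rfl)))
        (ih (.fst <| .var rfl) (.snd <| .fst <| .snd <| .var rfl) (.snd <| .snd <| .var rfl)))
      (by simp only [List.length_cons]; omega)

theorem runs_transaction {p q : ℕ} (hb : Runs F ρ e (encodeKey x) s)
    (ha : Runs F ρ e' (encodeKey y) s') (hq : Runs F ρ e₁ (.nat q) t)
    (hp : Runs F ρ e₂ (.price p) t') :
    Runs F ρ (Code.transaction e e' e₁ e₂) (encodeTransaction ⟨x.order, y.order, q, p⟩)
      (s + s' + t + t' + 10) :=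
  .mono (.pair (.fst <| .snd hb) <| .pair (.fst <| .snd ha) <| .pair hq hp) (by omega)

theorem runs_pairUp {p : ℕ} {Bs As : List (ℕ × Key)} (hp : Runs funs ρ e (.price p) s)
    (hB : Runs funs ρ e₁ (encodeList encodeItem Bs) t)
    (hA : Runs funs ρ e₂ (encodeList encodeItem As) t') :
    Runs funs ρ (Code.pairUp e e₁ e₂) (encodeOutput (pairUp p Bs As))
      (s + t + t' + 100 * (Bs.length + As.length) + 20) := by
  fun_induction pairUp p Bs As generalizing ρ e e₁ e₂ s t t' with
  | case1 b Bs a As hab ih =>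
    exact .mono (.call rfl (.pair hp (.pair hB hA)) <| .ifNil_pair (.fst <| .snd <| .var rfl) <|
      .ifNil_pair (.snd <| .snd <| .var rfl) <|
      .ifNatLe_le (.fst <| .fst <| .fst <| .snd <| .var rfl)
        (.fst <| .fst <| .snd <| .snd <| .var rfl) hab <|
      .pair
        (runs_transaction (.snd <| .fst <| .fst <| .snd <| .var rfl)
          (.snd <| .fst <| .snd <| .snd <| .var rfl)
          (.fst <| .fst <| .fst <| .snd <| .var rfl) (.fst <| .var rfl))
        (ih (.fst <| .var rfl) (.snd <| .fst <| .snd <| .var rfl) <|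
          .pair (.pair (.sub (.fst <| .fst <| .snd <| .snd <| .var rfl)
            (.fst <| .fst <| .fst <| .snd <| .var rfl)) (.snd <| .fst <| .snd <| .snd <| .var rfl))
            (.snd <| .snd <| .snd <| .var rfl)))
      (by simp only [List.length_cons]; omega)
  | case2 b Bs a As hab ih =>
    exact .mono (.call rfl (.pair hp (.pair hB hA)) <| .ifNil_pair (.fst <| .snd <| .var rfl) <|
      .ifNil_pair (.snd <| .snd <| .var rfl) <|
      .ifNatLe_gt (.fst <| .fst <| .fst <| .snd <| .var rfl)
        (.fst <| .fst <| .snd <| .snd <| .var rfl) (not_le.1 hab) <|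
      .pair
        (runs_transaction (.snd <| .fst <| .fst <| .snd <| .var rfl)
          (.snd <| .fst <| .snd <| .snd <| .var rfl)
          (.fst <| .fst <| .snd <| .snd <| .var rfl) (.fst <| .var rfl))
        (ih (.fst <| .var rfl)
          (.pair (.pair (.sub (.fst <| .fst <| .fst <| .snd <| .var rfl)
            (.fst <| .fst <| .snd <| .snd <| .var rfl)) (.snd <| .fst <| .fst <| .snd <| .var rfl))
            (.snd <| .fst <| .snd <| .var rfl))
          (.snd <| .snd <| .snd <| .var rfl)))
      (by simp only [List.length_cons]; omega)
  | case3 As =>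
    exact .mono (.call rfl (.pair hp (.pair hB hA)) <| .ifNil_nil (.fst <| .snd <| .var rfl) .nil)
      (by omega)
  | case4 b Bs =>
    exact .mono (.call rfl (.pair hp (.pair hB hA)) <| .ifNil_pair (.fst <| .snd <| .var rfl) <|
      .ifNil_nil (.snd <| .snd <| .var rfl) .nil) (by omega)

/-- The program selects from the list `L`, correctly and in linear time. -/
def Selects (L : List (ℕ × Key)) : Prop :=
  ∀ k l, weight L = k + l → L ≠ [] → ∃ y ∈ L, IsSplit rank y.2 k l L ∧
    Runs funs [.pair (encodeList encodeItem L) (.pair (.nat k) (.nat l))] Code.selectBody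
      (encodeKey y.2) (20000 * L.length)

theorem Selects.runs {L : List (ℕ × Key)} {k l s s' : ℕ} (h : Selects L) (hL : weight L = k + l)
    (hne : L ≠ []) (he : Runs funs ρ e (encodeList encodeItem L) s)
    (h₁ : Runs funs ρ e₁ (.nat k) s') (h₂ : Runs funs ρ e₂ (.nat l) t) :
    ∃ y ∈ L, IsSplit rank y.2 k l L ∧ Runs funs ρ (Code.select e e₁ e₂) (encodeKey y.2)
      (s + s' + t + 20000 * L.length + 5) := by
  obtain ⟨y, hy, hs, hrun⟩ := h k l hL hne
  exact ⟨y, hy, hs, .mono (.call rfl (.pair he (.pair h₁ h₂)) hrun) (by omega)⟩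

theorem exists_runs_pivot {L : List (ℕ × Key)} (hL : L ≠ [])
    (h : Selects (medians rank (medians rank L))) :
    ∃ y ∈ L, (below rank y.2 L).length + 2 * (medians rank (medians rank L)).length ≤ L.length ∧
      (above rank y.2 L).length + 2 * (medians rank (medians rank L)).length ≤ L.length ∧
      Runs funs [encodeList encodeItem (medians rank (medians rank L)),
        .pair (encodeList encodeItem L) v] (Code.pivot (.var 0) (.fst (.var 1))) (encodeKey y.2)
        (20100 * (medians rank (medians rank L)).length + 50) := by
  rcases hM : medians rank (medians rank L) with _ | ⟨z, M⟩
  · obtain ⟨y, L, rfl⟩ := List.exists_cons_of_ne_nil hL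
    exact ⟨y, List.mem_cons_self, List.length_filter_le .., List.length_filter_le ..,
      .mono (.ifNil_nil (.var rfl) (.snd <| .fst <| .fst <| .var rfl)) (by omega)⟩
  · rw [← hM]
    obtain ⟨y, hy, hs, hrun⟩ := h.runs
      (by rw [weight_eq_mul_length fun _ => fst_of_mem_medians, two_mul]) (by simp [hM])
      (.var rfl) (runs_length (.var rfl)) (runs_length (.var rfl))
      (ρ := [_, .pair (encodeList encodeItem L) v]) (e := .var 0) (e₁ := Code.length (.var 0))
      (e₂ := Code.length (.var 0))
    obtain ⟨y', hy', hyy'⟩ := exists_mem_of_mem_medians hy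
    obtain ⟨y'', hy'', hyy''⟩ := exists_mem_of_mem_medians hy'
    rw [← hyy', ← hyy''] at hs hrun
    refine ⟨y'', hy'', hs.length_below_medians_medians_le, hs.length_above_medians_medians_le, ?_⟩
    rw [hM] at hrun ⊢
    exact .mono (.ifNil_pair (.var rfl) hrun) (by omega)

theorem exists_runs_descend {L : List (ℕ × Key)} {y : ℕ × Key} {k l n : ℕ} (hy : y ∈ L)
    (hL : weight L = k + l) (hb : Selects (below rank y.2 L)) (ha : Selects (above rank y.2 L))
    (hbn : (below rank y.2 L).length ≤ n) (han : (above rank y.2 L).length ≤ n) :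
    ∃ z ∈ L, IsSplit rank z.2 k l L ∧
      Runs funs
        [.pair (encodeList encodeItem (below rank y.2 L))
            (encodeList encodeItem (above rank y.2 L)),
          encodeKey y.2, v, .pair w (.pair (.nat k) (.nat l))]
        (Code.descend (.fst (.var 0)) (.var 1) (.snd (.var 0)) (.fst (.snd (.var 3)))
          (.snd (.snd (.var 3)))) (encodeKey z.2) (20100 * n + 100) := by
  set ρ := [Val.pair (encodeList encodeItem (below rank y.2 L))
    (encodeList encodeItem (above rank y.2 L)), encodeKey y.2, v, .pair w (.pair (.nat k) (.nat l))]
  have hbelows : Runs funs ρ (.fst (.var 0)) (encodeList encodeItem (below rank y.2 L)) 2 :=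
    .fst <| .var rfl
  have haboves : Runs funs ρ (.snd (.var 0)) (encodeList encodeItem (above rank y.2 L)) 2 :=
    .snd <| .var rfl
  have hkρ : Runs funs ρ (.fst (.snd (.var 3))) (.nat k) 3 := .fst <| .snd <| .var rfl
  have hlρ : Runs funs ρ (.snd (.snd (.var 3))) (.nat l) 3 := .snd <| .snd <| .var rfl
  have hwb := runs_weight hbelows
  have hwa := runs_weight haboves
  rcases le_or_gt (weight (below rank y.2 L)) k with hk | hk
  · rcases le_or_gt (weight (above rank y.2 L)) l with hl | hl
    · exact ⟨y, hy, ⟨hk, hl⟩,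
        .mono (.ifNatLe_le hwb hkρ hk <| .ifNatLe_le hwa hlρ hl (.var rfl)) (by omega)⟩
    · obtain ⟨z, hz, hs, hrun⟩ := ha.runs (Nat.sub_add_cancel hl.le).symm
        (by rintro h; simp [h, weight] at hl) haboves (.sub hwa hlρ) hlρ
      obtain ⟨hzL, hlt⟩ := mem_above.1 hz
      exact ⟨z, hzL, .of_above hlt hl.le hL hs,
        .mono (.ifNatLe_le hwb hkρ hk <| .ifNatLe_gt hwa hlρ hl hrun) (by omega)⟩
  · obtain ⟨z, hz, hs, hrun⟩ := hb.runs (Nat.add_sub_cancel' hk.le).symm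
      (by rintro h; simp [h, weight] at hk) hbelows hkρ (.sub hwb hkρ)
    obtain ⟨hzL, hlt⟩ := mem_below.1 hz
    exact ⟨z, hzL, .of_below hlt hk.le hL hs, .mono (.ifNatLe_gt hwb hkρ hk hrun) (by omega)⟩

theorem selects (L : List (ℕ × Key)) : Selects L := by
  induction hn : L.length using Nat.strong_induction_on generalizing L with
  | _ n ih =>
    subst hn
    intro k l hL hne
    have hpos := List.length_pos_of_ne_nil hne
    have hM : (medians rank (medians rank L)).length = L.length / 3 / 3 := by
      rw [length_medians, length_medians]
    obtain ⟨y, hy, hb, ha, hpivot⟩ := exists_runs_pivot hne (ih _ (by omega) _ rfl)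
    have hb' := length_below_lt_length (r := rank) hy
    have ha' := length_above_lt_length (r := rank) hy
    -- The `1` is for the short lists, which have no medians of medians: the pivot still drops out.
    obtain ⟨z, hz, hs, hdescend⟩ := exists_runs_descend hy hL (ih _ hb' _ rfl) (ih _ ha' _ rfl)
      (n := L.length - max 1 (2 * (L.length / 3 / 3))) (by omega) (by omega)
    refine ⟨z, hz, hs, .mono (.bind (runs_medians <| runs_medians <| .fst <| .var rfl) <|
      .bind hpivot <| .bind (runs_partition (.var rfl) (.fst <| .var rfl)) hdescend) ?_⟩
    rw [length_medians, hM]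
    omega

theorem runs_settle {B A : List Order} (hx : Runs funs ρ e (encodeKey x) 1)
    (hB : Runs funs ρ e₁ (encodeList encodeItem (above rank x (items bid B))) 1)
    (hA : Runs funs ρ e₂ (encodeList encodeItem (below rank x (items ask A))) 1) :
    Runs funs ρ (Code.settle e e₁ e₂)
      (encodeOutput (pairUp x.order.price (tradedBids x B A) (tradedAsks x B A)))
      (200 * (B.length + A.length) + 200) := by
  have hlB : (above rank x (items bid B)).length ≤ B.length :=
    (List.length_filter_le ..).trans_eq (length_items ..)
  have hlA : (below rank x (items ask A)).length ≤ A.length :=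
    (List.length_filter_le ..).trans_eq (length_items ..)
  cases x with
  | ask a =>
    exact .mono (.ifNil_nil (.fst hx) <| runs_pairUp (runs_price hx) hB <|
      .pair (.pair (.sub (runs_weight hB) (runs_weight hA)) hx) hA)
      (by simp only [tradedBids, tradedAsks, List.length_cons]; omega)
  | bid b =>
    exact .mono (.ifNil_pair (.fst hx) <| runs_pairUp (runs_price hx)
      (.pair (.pair (.sub (runs_weight hA) (runs_weight hB)) hx) hB) hA)
      (by simp only [tradedBids, tradedAsks, List.length_cons]; omega)

theorem exists_isAllocation_runs_clear {B A : List Order} (hB : (B.map Order.timestamp).Nodup)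
    (hA : (A.map Order.timestamp).Nodup) (hne : items bid B ++ items ask A ≠ []) :
    ∃ x Bs As, IsAllocation B A x Bs As ∧
      Runs funs [encodeList encodeItem (items bid B ++ items ask A),
        encodeList encodeItem (items ask A), encodeList encodeItem (items bid B), v] Code.clear
        (encodeOutput (pairUp x.order.price Bs As)) (25000 * (B.length + A.length) + 500) := by
  have hlB := length_items bid B
  have hlA := length_items ask A
  obtain ⟨y, hy, hs, hselect⟩ := (selects _).runs (weight_append ..) hne (.var rfl)
    (runs_weight (.var rfl)) (runs_weight (.var rfl))
    (ρ := [encodeList encodeItem (items bid B ++ items ask A), encodeList encodeItem (items ask A),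
      encodeList encodeItem (items bid B), v])
    (e := .var 0) (e₁ := Code.weight (.var 2)) (e₂ := Code.weight (.var 1))
  refine ⟨y.2, _, _, isAllocation_of_isSplit hB hA hy hs,
    .mono (.bind hselect <| .bind (.snd <| runs_partition (.var rfl) (.var rfl)) <|
      .bind (.fst <| runs_partition (.var rfl) (.var rfl)) <|
      runs_settle (.var rfl) (.var rfl) (.var rfl)) ?_⟩
  rw [List.length_append]
  omega

theorem exists_isAllocation_runs_main {B A : List Order} (hB : (B.map Order.timestamp).Nodup)
    (hA : (A.map Order.timestamp).Nodup) : ∃ x Bs As, IsAllocation B A x Bs As ∧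
      Runs funs [encodeInput B A] Code.main (encodeOutput (pairUp x.order.price Bs As))
        (30000 * (B.length + A.length) + 1000) := by
  have hbids := runs_items (f := bid) (L := B) (R := []) (ρ := [encodeInput B A])
    (e₁ := .fst (.var 0)) (fun _ => rfl) (.pair .nil .nil) (.fst <| .var rfl) .nil
  have hasks := runs_items (f := ask) (L := A) (R := [])
    (ρ := [encodeList encodeItem (items bid B), encodeInput B A])
    (e₁ := .snd (.var 1)) (fun _ => rfl) .nil (.snd <| .var rfl) .nil
  have hbook := runs_items (f := bid) (L := B) (R := items ask A)
    (ρ := [encodeList encodeItem (items ask A), encodeList encodeItem (items bid B),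
      encodeInput B A]) (e₁ := .fst (.var 2)) (e₂ := .var 0) (fun _ => rfl) (.pair .nil .nil)
    (.fst <| .var rfl) (.var rfl)
  rw [List.append_nil] at hbids hasks
  rcases eq_or_ne (items bid B ++ items ask A) [] with hnil | hne
  · obtain ⟨hB', hA'⟩ := List.append_eq_nil_iff.1 hnil
    rw [hnil] at hbook
    refine ⟨ask ⟨0, 0, 1, 0, le_rfl⟩, [], [], ⟨?_, ?_, rfl⟩, .mono (.bind hbids <| .bind hasks <|
      .bind hbook <| .ifNil_nil (.var rfl) (t := 1) ?_) ?_⟩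
    · rw [hB']
      exact isTruncation_below ..
    · rw [hA']
      exact isTruncation_below ..
    · rw [pairUp]
      exact .nil
    · omega
  · obtain ⟨x, Bs, As, halloc, hclear⟩ := exists_isAllocation_runs_clear hB hA hne
    obtain ⟨z, L, hcons⟩ := List.exists_cons_of_ne_nil hne
    refine ⟨x, Bs, As, halloc, .mono (.bind hbids <| .bind hasks <| .bind hbook <|
      .ifNil_pair (.var (v := .pair (encodeItem z) (encodeList encodeItem L)) ?_) hclear)
      (by omega)⟩
    rw [hcons]
    rfl

end Correctness

theorem isBigO_linear (a b : ℕ) :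
    (fun n : ℕ => ((a * n + b : ℕ) : ℝ)) =O[atTop] fun n : ℕ => (n : ℝ) := by
  refine IsBigO.of_bound (a + b : ℕ) ?_
  filter_upwards [eventually_ge_atTop 1] with n hn
  rw [Real.norm_natCast, Real.norm_natCast]
  norm_cast
  nlinarith

end Exchange

theorem theorem5_general :
    ∃ (P : Exchange.Program) (T : ℕ → ℕ),
      ((fun n : ℕ => (T n : ℝ)) =O[Filter.atTop] fun n : ℕ => (n : ℝ)) ∧
      ∀ B A : List Exchange.Order,
        B.Disjoint A →
        (B.map Exchange.Order.timestamp).Nodup →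
        (A.map Exchange.Order.timestamp).Nodup →
        ∃ (M : List Exchange.Transaction) (t : ℕ),
          P.HaltsWith (Exchange.encodeInput B A) (Exchange.encodeOutput M) t ∧
          t ≤ T (B.length + A.length) ∧
          M.Nodup ∧
          Exchange.IsMatching B A M ∧
          Exchange.IsUniform M ∧
          Exchange.IsFair B A M ∧
          ∀ M' : List Exchange.Transaction,
            Exchange.IsMatching B A M' → Exchange.IsUniform M' →
              Exchange.volume M' ≤ Exchange.volume M := by
  refine ⟨⟨Exchange.Code.funs, Exchange.Code.main⟩, fun n => 30000 * n + 1000,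
    Exchange.isBigO_linear _ _, fun B A hdisj hB hA => ?_⟩
  obtain ⟨x, Bs, As, halloc, t, ht, hrun⟩ := Exchange.exists_isAllocation_runs_main hB hA
  have hd : (B ++ A).Nodup := hB.of_map.append hA.of_map hdisj
  have hitems := halloc.nodup hd
  rw [List.map_append] at hitems
  exact ⟨Exchange.pairUp x.order.price Bs As, t, hrun, ht,
    Exchange.nodup_pairUp hitems.of_append_left hitems.of_append_right, halloc.isMatching hd,
    ⟨x.order.price, fun m hm => (Exchange.mem_of_mem_pairUp hm).2.2⟩,
    ⟨halloc.fairOnBids hd, halloc.fairOnAsks hd⟩, fun M' => halloc.volume_le⟩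

theorem theorem5 :
    ∃ (P : Exchange.Program) (T : ℕ → ℕ),
      ((fun n : ℕ => (T n : ℝ)) =O[Filter.atTop] fun n : ℕ => (n : ℝ)) ∧
      ∀ B A : List Exchange.Order,
        ((B ++ A).map Exchange.Order.id).Nodup →
        ((B ++ A).map Exchange.Order.timestamp).Nodup →
        ∃ (M : List Exchange.Transaction) (t : ℕ),
          P.HaltsWith (Exchange.encodeInput B A) (Exchange.encodeOutput M) t ∧
          t ≤ T (B.length + A.length) ∧
          M.Nodup ∧
          Exchange.IsMatching B A M ∧
          Exchange.IsUniform M ∧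
          Exchange.IsFair B A M ∧
          ∀ M' : List Exchange.Transaction,
            Exchange.IsMatching B A M' → Exchange.IsUniform M' →
              Exchange.volume M' ≤ Exchange.volume M := by
  obtain ⟨P, T, hT, hP⟩ := theorem5_general
  exact ⟨P, T, hT, fun B A _ hts => hP B A (List.disjoint_of_nodup_append hts.of_map)
    (hts.sublist ((B.sublist_append_left A).map _))
    (hts.sublist ((B.sublist_append_right A).map _))⟩
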